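/- Let $X$ be a real reflexive Banach space with dual $X^*$ and dual norm $\|\cdot\|_*$, let $T$ be a non-empty set, let $\Phi_t:X\to\mathbb R\cup\{+\infty\}$ $(t\in T)$ be proper, convex and lower semicontinuous functions, and put $\Phi:=\sup_{t\in T}\Phi_t$. For $\varepsilon\ge 0$ and $\Phi_t(x)<+\infty$ let $$\partial_\varepsilon\Phi_t(x):=\{x^*\in X^* : \langle x^*,u-x\rangle\le\Phi_t(u)-\Phi_t(x)+\varepsilon\ \ \forall u\in X\}.$$ Then for every $\bar x\in X$ with $\Phi(\bar x)<+\infty$ and every $\delta\ge 0$, the $\delta$-normal set $$\mathrm N^{\delta}_{[\Phi\le\Phi(\bar x)]}(\bar x):=\{x^*\in X^* : \langle x^*,u-\bar x\rangle\le\delta\ \text{ for all } u\in X \text{ with } \Phi(u)\le\Phi(\bar x)\}$$ satisfies $$\mathrm N^{\delta}_{[\Phi\le\Phi(\bar x)]}(\bar x)=\|\cdot\|_*\text{-}\limsup_{\substack{\sum_{i=1}^k\mu_i(\Phi(\bar x)-\Phi_{t_i}(\bar x)+\varepsilon_i)\to\delta\\ \mu_i\ge 0,\ \varepsilon_i\ge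 0,\ t_i\in T,\ k\ge 1}}\ \sum_{i=1}^k\mu_i\,\partial_{\varepsilon_i}\Phi_{t_i}(\bar x).$$ Here the right-hand side is the Painlevé–Kuratowski upper limit in the norm topology of $X^*$, that is, the set of all $x^*\in X^*$ such that for every norm neighbourhood $W$ of $x^*$ and every $\eta>0$ there are $k\ge1$, $t_i\in T$, $\mu_i\ge0$ and $\varepsilon_i\ge0$ $(i=1,\dots,k)$ with $\left|\sum_{i=1}^k\mu_i(\Phi(\bar x)-\Phi_{t_i}(\bar x)+\varepsilon_i)-\delta\right|<\eta$ and $\left(\sum_{i=1}^k\mu_i\,\partial_{\varepsilon_i}\Phi_{t_i}(\bar x)\right)\cap W\ne\emptyset$ (Minkowski sums; $0\cdot\emptyset=\emptyset$). -/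

import Mathlib

open scoped Pointwise Topology

noncomputable section

namespace ConvexSublevel

/-- A normed space is reflexive if the canonical embedding into its bidual is onto. -/
def IsReflexiveSpace (X : Type*) [NormedAddCommGroup X] [NormedSpace ℝ X] : Prop :=
  Function.Surjective (NormedSpace.inclusionInDoubleDual ℝ X)

/-- The (effective) domain of an extended-real-valued function. -/
def effDom {X : Type*} (f : X → EReal) : Set X := {x | f x < ⊤}

/-- The epigraph, a subset of `X × ℝ`. -/
def epi {X : Type*} (f : X → EReal) : Set (X × ℝ) := {p | f p.1 ≤ (p.2 : EReal)}

/-- `f ∈ Γ₀(X)`: a function with values in `ℝ ∪ {+∞}` that is proper, convex (its epigraph is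
convex) and lower semicontinuous (its epigraph is closed). -/
structure IsGammaZero {X : Type*} [NormedAddCommGroup X] [NormedSpace ℝ X]
    (f : X → EReal) : Prop where
  ne_bot : ∀ x, f x ≠ ⊥
  proper : (effDom f).Nonempty
  convex : Convex ℝ (epi f)
  lsc : IsClosed (epi f)

/-- The sublevel set `[f ≤ r]`. -/
def sublevel {X : Type*} (f : X → EReal) (r : EReal) : Set X := {x | f x ≤ r}

/-- The `δ`-normal set `N_S^δ(x)`, as a subset of the topological dual. -/
def normalSet {X : Type*} [NormedAddCommGroup X] [NormedSpace ℝ X]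
    (δ : ℝ) (S : Set X) (x : X) : Set (StrongDual ℝ X) :=
  {xs | ∀ u ∈ S, xs (u - x) ≤ δ}

/-- The `ε`-subdifferential `∂_ε f(x)`; it is empty if `ε < 0` or `x ∉ dom f`. -/
def epsSubdiff {X : Type*} [NormedAddCommGroup X] [NormedSpace ℝ X]
    (ε : ℝ) (f : X → EReal) (x : X) : Set (StrongDual ℝ X) :=
  {xs | 0 ≤ ε ∧ x ∈ effDom f ∧
    ∀ u : X, ((xs (u - x) : ℝ) : EReal) ≤ f u - f x + (ε : EReal)}

/-- The Painlevé-Kuratowski upper limit of a multifunction `M` along a filter `l`: the points `v`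
such that for every neighbourhood `W` of `v` and every `Z ∈ l` there is `u ∈ Z` for which
`M u` meets `W`. The topology is the one of the instance on `V`. -/
def upperLimit {U V : Type*} [TopologicalSpace V] (l : Filter U) (M : U → Set V) : Set V :=
  {v | ∀ W ∈ 𝓝 v, ∀ Z ∈ l, ∃ u ∈ Z, (M u ∩ W).Nonempty}

/-- The parameters of the upper limit: a positive integer `k`, indices `t₁, …, t_k ∈ T`, and
numbers `μᵢ ≥ 0`, `εᵢ ≥ 0`. -/
structure Param (T : Type*) where
  k : ℕ
  k_pos : 1 ≤ k
  t : Fin k → T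
  μ : Fin k → ℝ
  ε : Fin k → ℝ
  μ_nonneg : ∀ i, 0 ≤ μ i
  ε_nonneg : ∀ i, 0 ≤ ε i

/-- The number `∑ᵢ μᵢ (Φ(x) - Φ_{tᵢ}(x) + εᵢ)`, where `Φ = sup_t Φ_t`. It is used only at points
`x` where `Φ` (hence each `Φ_t`) is finite, so that `toReal` is the actual value. -/
def Param.weight {X T : Type*} (Φ : T → X → EReal) (x : X) (p : Param T) : ℝ :=
  ∑ i, p.μ i * ((⨆ t, Φ t x).toReal - (Φ (p.t i) x).toReal + p.ε i)

/-- The Minkowski sum `∑ᵢ μᵢ ∂_{εᵢ} Φ_{tᵢ}(x)`. -/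
def Param.subdiffSum {X T : Type*} [NormedAddCommGroup X] [NormedSpace ℝ X]
    (Φ : T → X → EReal) (x : X) (p : Param T) : Set (StrongDual ℝ X) :=
  ∑ i, p.μ i • epsSubdiff (p.ε i) (Φ (p.t i)) x

end ConvexSublevel

end

namespace ConvexSublevel

section

variable {X : Type*} [NormedAddCommGroup X] [NormedSpace ℝ X]

/-! An `ε`-subgradient of `Φ t` at `x` is the slope of an affine minorant `v - s`, with `s + m - v x
= m - Φ t x + ε` for `m = Φ(x)`. So the right-hand side is the set of `xs` with `(xs, δ)` in the
closure of the convex cone spanned by the pairs `(v, s + m - v x)`. If `(xs, δ)` lies outside,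
Hahn–Banach and reflexivity give `u` and `r ≥ 0` with `v u ≤ r * w` on the cone but `xs u > r * δ`.
By Fenchel–Moreau, `x + l • u` is in the sublevel set whenever `l ≥ 0` and `l * r ≤ 1`, so `l * xs u
≤ δ`: absurd for suitable `l`. The other inclusion is a direct estimate. -/

/-- The continuous affine function `v - s` minorizes `f`. -/
def IsAffineMinorant (f : X → EReal) (v : StrongDual ℝ X) (s : ℝ) : Prop :=
  ∀ u, ((v u - s : ℝ) : EReal) ≤ f u

theorem mem_epsSubdiff_iff {f : X → EReal} {x : X} {a ε : ℝ} (ha : f x = a)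
    {v : StrongDual ℝ X} :
    v ∈ epsSubdiff ε f x ↔ 0 ≤ ε ∧ IsAffineMinorant f v (v x - a + ε) := by
  have key : ∀ u, (((v (u - x) : ℝ) : EReal) ≤ f u - f x + (ε : EReal) ↔
      ((v u - (v x - a + ε) : ℝ) : EReal) ≤ f u) := by
    intro u
    rw [ha, map_sub]
    induction f u with
    | bot => simp [sub_eq_add_neg]
    | top => simp
    | coe b =>
      norm_cast
      constructor <;> intro h <;> linarith
  have hdom : x ∈ effDom f := by
    change f x < ⊤
    rw [ha]
    exact EReal.coe_lt_top a
  exact ⟨fun h => ⟨h.1, fun u => (key u).1 (h.2.2 u)⟩,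
    fun h => ⟨h.1, hdom, fun u => (key u).2 (h.2 u)⟩⟩

/-! ### Separation and Fenchel–Moreau -/

theorem apply_mk_eq {E : Type*} [NormedAddCommGroup E] [NormedSpace ℝ E]
    (g : StrongDual ℝ (E × ℝ)) (e : E) (r : ℝ) :
    g (e, r) = g.comp (ContinuousLinearMap.inl ℝ E ℝ) e + r * g (0, 1) := by
  have : ((e, r) : E × ℝ) = (e, 0) + r • ((0, 1) : E × ℝ) := by simp
  rw [this, map_add, map_smul]
  simp

/-- A point outside the epigraph of a function in `Γ₀` is separated from it by a hyperplane. -/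
theorem IsGammaZero.exists_separation {f : X → EReal} (hf : IsGammaZero f) {y : X} {r : ℝ}
    (h : (r : EReal) < f y) :
    ∃ (v : StrongDual ℝ X) (a c : ℝ), 0 ≤ a ∧ c < v y - a * r ∧
      ∀ (u : X) (s : ℝ), f u ≤ s → v u - a * s < c := by
  obtain ⟨g, c, hg, hc⟩ := geometric_hahn_banach_closed_point hf.convex hf.lsc
    (show (y, r) ∉ epi f from not_le.2 h)
  refine ⟨g.comp (ContinuousLinearMap.inl ℝ X ℝ), -g (0, 1), c, ?_, ?_, ?_⟩
  · by_contra! hneg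
    have hpos : 0 < g (0, 1) := by linarith
    obtain ⟨x₀, hx₀⟩ := hf.proper
    obtain ⟨n, hn⟩ := exists_nat_gt
      ((c - g.comp (ContinuousLinearMap.inl ℝ X ℝ) x₀) / g (0, 1))
    have h1 := hg (x₀, max (f x₀).toReal n)
      ((EReal.le_coe_toReal hx₀.ne).trans (EReal.coe_le_coe_iff.2 (le_max_left _ _)))
    rw [apply_mk_eq] at h1
    rw [div_lt_iff₀ hpos] at hn
    nlinarith [le_max_right (f x₀).toReal (n : ℝ)]
  · rw [apply_mk_eq] at hc
    linarith
  · intro u s hs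
    have h1 := hg (u, s) hs
    rw [apply_mk_eq] at h1
    linarith

theorem isAffineMinorant_of_separation {f : X → EReal} (hbot : ∀ x, f x ≠ ⊥)
    {v : StrongDual ℝ X} {a c : ℝ} (ha : 0 < a)
    (h : ∀ (u : X) (s : ℝ), f u ≤ s → v u - a * s < c) :
    IsAffineMinorant f (a⁻¹ • v) (a⁻¹ * c) := by
  intro u
  have hb := hbot u
  have hu := h u
  revert hb hu
  induction f u with
  | bot => simp
  | top => simp
  | coe b =>
    intro _ hu
    have h1 := hu b le_rfl
    rw [EReal.coe_le_coe_iff]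
    change a⁻¹ * v u - a⁻¹ * c ≤ b
    rw [← mul_sub, inv_mul_le_iff₀ ha]
    linarith

theorem IsGammaZero.exists_isAffineMinorant {f : X → EReal} (hf : IsGammaZero f) :
    ∃ v s, IsAffineMinorant f v s := by
  obtain ⟨x₀, hx₀⟩ := hf.proper
  have hcoe : (((f x₀).toReal : ℝ) : EReal) = f x₀ := EReal.coe_toReal hx₀.ne (hf.ne_bot x₀)
  obtain ⟨v, a, c, ha, h1, h2⟩ := hf.exists_separation (y := x₀) (r := (f x₀).toReal - 1) (by
    conv_rhs => rw [← hcoe]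
    exact EReal.coe_lt_coe_iff.2 (by linarith))
  have h3 := h2 x₀ _ hcoe.ge
  exact ⟨_, _, isAffineMinorant_of_separation hf.ne_bot (by linarith) h2⟩

/-- Fenchel–Moreau: a function in `Γ₀` is bounded at `y` by any common bound of its continuous
affine minorants. -/
theorem IsGammaZero.le_of_forall_isAffineMinorant {f : X → EReal} (hf : IsGammaZero f) {y : X}
    {r : ℝ} (h : ∀ v s, IsAffineMinorant f v s → v y - s ≤ r) : f y ≤ r := by
  by_contra! hlt
  obtain ⟨v, a, c, ha, h1, h2⟩ := hf.exists_separation hlt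
  -- Vertical hyperplane: `v < c` on the domain and `v y > c`, so adding `n * (v - c)` to a minorant
  -- keeps it one and sends its value at `y` to infinity.
  rcases ha.eq_or_lt with rfl | ha
  · obtain ⟨w, s, hw⟩ := hf.exists_isAffineMinorant
    have hpos : 0 < v y - c := by linarith
    obtain ⟨n, hn⟩ := exists_nat_gt ((r - (w y - s)) / (v y - c))
    rw [div_lt_iff₀ hpos] at hn
    have h3 := h (w + (n : ℝ) • v) (s + n * c) (by
      intro u
      rcases eq_or_ne (f u) ⊤ with hu | hu
      · simp [hu]
      · have h4 := h2 u (f u).toReal (EReal.le_coe_toReal hu)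
        refine le_trans (EReal.coe_le_coe_iff.2 ?_) (hw u)
        change w u + n * v u - (s + n * c) ≤ w u - s
        nlinarith [(Nat.cast_nonneg n : (0 : ℝ) ≤ n)])
    change w y + n * v y - (s + n * c) ≤ r at h3
    linarith
  · have h3 := h _ _ (isAffineMinorant_of_separation hf.ne_bot ha h2)
    change a⁻¹ * v y - a⁻¹ * c ≤ r at h3
    rw [← mul_sub, inv_mul_le_iff₀ ha] at h3
    linarith

/-! ### Minkowski sums and the cone of minorants -/

variable {T : Type*}

theorem Param.mem_subdiffSum {Φ : T → X → EReal} {x : X} {p : Param T} {v : StrongDual ℝ X} :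
    v ∈ p.subdiffSum Φ x ↔ ∃ w : Fin p.k → StrongDual ℝ X,
      (∀ i, w i ∈ epsSubdiff (p.ε i) (Φ (p.t i)) x) ∧ ∑ i, p.μ i • w i = v := by
  rw [Param.subdiffSum, Set.mem_fintype_sum]
  constructor
  · rintro ⟨g, hg, rfl⟩
    choose w hw hwg using fun i => Set.mem_smul_set.1 (hg i)
    exact ⟨w, hw, by simp [hwg]⟩
  · rintro ⟨w, hw, rfl⟩
    exact ⟨_, fun i => Set.smul_mem_smul_set (hw i), rfl⟩

theorem Param.apply_sub_le_weight {Φ : T → X → EReal} {x : X} {m : ℝ} {a : T → ℝ}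
    (hm : ⨆ t, Φ t x = m) (ha : ∀ t, Φ t x = a t) {p : Param T} {v : StrongDual ℝ X}
    (hv : v ∈ p.subdiffSum Φ x) {u : X} (hu : ⨆ t, Φ t u ≤ m) :
    v (u - x) ≤ p.weight Φ x := by
  obtain ⟨w, hw, rfl⟩ := Param.mem_subdiffSum.1 hv
  rw [Param.weight, sum_apply]
  refine Finset.sum_le_sum fun i _ => ?_
  change p.μ i * w i (u - x) ≤ _
  refine mul_le_mul_of_nonneg_left ?_ (p.μ_nonneg i)
  have h1 := ((mem_epsSubdiff_iff (ha _)).1 (hw i)).2 u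
  have h2 := EReal.coe_le_coe_iff.1 (h1.trans ((le_iSup (fun t => Φ t u) _).trans hu))
  rw [hm, ha, EReal.toReal_coe, EReal.toReal_coe, map_sub]
  linarith

/-- The pairs `(v, s + m - v x)` for `v - s` an affine minorant of some `Φ t`. -/
def minorantPairs (Φ : T → X → EReal) (x : X) (m : ℝ) : Set (StrongDual ℝ X × ℝ) :=
  {q | ∃ t, IsAffineMinorant (Φ t) q.1 (q.2 - m + q.1 x)}

theorem exists_param_of_mem_span {Φ : T → X → EReal} {x : X} {m : ℝ} {a : T → ℝ}
    (hm : ⨆ t, Φ t x = m) (ha : ∀ t, Φ t x = a t) (hne : (minorantPairs Φ x m).Nonempty)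
    {q : StrongDual ℝ X × ℝ} (hq : q ∈ Submodule.span NNReal (minorantPairs Φ x m)) :
    ∃ p : Param T, q.1 ∈ p.subdiffSum Φ x ∧ p.weight Φ x = q.2 := by
  obtain ⟨q₀, hq₀⟩ := hne
  obtain ⟨n, c, g, rfl⟩ := Submodule.mem_span_set'.1 hq
  -- The span allows `n = 0`, whereas `Param` needs `k ≥ 1`; a zero term on an actual minorant pads
  -- the sum.
  let c' : Fin (n + 1) → NNReal := Fin.cons 0 c
  let g' : Fin (n + 1) → minorantPairs Φ x m := Fin.cons ⟨q₀, hq₀⟩ g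
  have hsum : ∑ i, c i • (g i : StrongDual ℝ X × ℝ) =
      ∑ i, c' i • (g' i : StrongDual ℝ X × ℝ) := by
    simp [Fin.sum_univ_succ, c', g']
  rw [hsum]
  choose t ht using fun i => (g' i).2
  have hmin : ∀ i, (g' i).1.1 ∈ epsSubdiff ((g' i).1.2 - m + a (t i)) (Φ (t i)) x := by
    intro i
    have h1 := ht i x
    rw [ha, EReal.coe_le_coe_iff] at h1
    refine (mem_epsSubdiff_iff (ha _)).2 ⟨by linarith, ?_⟩
    convert ht i using 1
    ring
  refine ⟨⟨n + 1, by omega, t, fun i => c' i, fun i => (g' i).1.2 - m + a (t i),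
    fun i => (c' i).2, fun i => (hmin i).1⟩, Param.mem_subdiffSum.2
      ⟨fun i => (g' i).1.1, hmin, ?_⟩, ?_⟩
  · rw [Prod.fst_sum]
    rfl
  · rw [Prod.snd_sum, Param.weight]
    refine Finset.sum_congr rfl fun i _ => ?_
    rw [hm, ha, EReal.toReal_coe, EReal.toReal_coe]
    change (c' i : ℝ) * _ = (c' i : ℝ) * (g' i).1.2
    ring

theorem mem_closure_span_minorantPairs (hX : IsReflexiveSpace X) {Φ : T → X → EReal}
    (hΦ : ∀ t, IsGammaZero (Φ t)) {x : X} {m δ : ℝ} (hm : ⨆ t, Φ t x = m)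
    (hne : (minorantPairs Φ x m).Nonempty) (hδ : 0 ≤ δ) {xs : StrongDual ℝ X}
    (hxs : ∀ u, (∀ t, Φ t u ≤ m) → xs (u - x) ≤ δ) :
    (xs, δ) ∈ closure (Submodule.span NNReal (minorantPairs Φ x m) :
      Set (StrongDual ℝ X × ℝ)) := by
  set K := Submodule.span NNReal (minorantPairs Φ x m)
  by_contra hnot
  have hconv : Convex ℝ (K : Set (StrongDual ℝ X × ℝ)) := by
    intro p hp q hq a b ha hb _
    exact K.add_mem (K.smul_mem ⟨a, ha⟩ hp) (K.smul_mem ⟨b, hb⟩ hq)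
  obtain ⟨g, c, hg, hc⟩ := geometric_hahn_banach_closed_point hconv.closure isClosed_closure hnot
  replace hg : ∀ q ∈ K, g q < c := fun q hq => hg q (subset_closure hq)
  have hc0 : 0 < c := by simpa using hg 0 K.zero_mem
  -- A linear functional bounded above on a cone is nonpositive there.
  have hg0 : ∀ q ∈ K, g q ≤ 0 := by
    intro q hq
    by_contra! hpos
    obtain ⟨n, hn⟩ := exists_nat_gt (c / g q)
    rw [div_lt_iff₀ hpos] at hn
    have h1 := hg _ (K.smul_mem (n : NNReal) hq)
    have h2 : (n : NNReal) • q = (n : ℝ) • q := by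
      rw [NNReal.smul_def, NNReal.coe_natCast]
    rw [h2, map_smul, smul_eq_mul] at h1
    linarith
  obtain ⟨u, hu⟩ := hX (g.comp (ContinuousLinearMap.inl ℝ (StrongDual ℝ X) ℝ))
  have happ : ∀ (v : StrongDual ℝ X) (w : ℝ), g (v, w) = v u + w * g (0, 1) := by
    intro v w
    rw [apply_mk_eq, ← hu, NormedSpace.dual_def]
  have hgen : ∀ t v s, IsAffineMinorant (Φ t) v s → v u + (s + m - v x) * g (0, 1) ≤ 0 := by
    intro t v s h
    rw [← happ]
    refine hg0 _ (Submodule.subset_span ⟨t, ?_⟩)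
    convert h using 1
    ring
  obtain ⟨r, hr⟩ : ∃ r, g (0, 1) = -r := ⟨-g (0, 1), by ring⟩
  rw [happ, hr] at hc
  -- Raising `s` keeps a minorant, so the second coordinate is unbounded above on the cone.
  have hr0 : 0 ≤ r := by
    by_contra! hneg
    obtain ⟨⟨v, w⟩, t, hq⟩ := hne
    obtain ⟨n, hn⟩ := exists_nat_gt ((-v u - w * (-r)) / (-r))
    rw [div_lt_iff₀ (by linarith)] at hn
    have h1 := hgen t v (w - m + v x + n) (fun y =>
      (EReal.coe_le_coe_iff.2 (by
        dsimp only
        linarith [(Nat.cast_nonneg n : (0 : ℝ) ≤ n)])).trans (hq y))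
    rw [hr] at h1
    nlinarith
  have hstep : ∀ l : ℝ, 0 ≤ l → l * r ≤ 1 → l * xs u ≤ δ := by
    intro l hl hlr
    have h1 := hxs (x + l • u) (fun t => (hΦ t).le_of_forall_isAffineMinorant (by
      intro v s h
      have h2 := hgen t v s h
      have h3 := EReal.coe_le_coe_iff.1
        ((h x).trans ((le_iSup (fun t => Φ t x) t).trans hm.le))
      rw [hr] at h2
      rw [map_add, map_smul, smul_eq_mul]
      nlinarith [mul_le_mul_of_nonneg_left h2 hl,
        mul_le_mul_of_nonneg_right hlr (by linarith : 0 ≤ s + m - v x)]))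
    simpa using h1
  -- For `r = 0` every `l ≥ 0` is allowed; otherwise `l = r⁻¹` is the extreme choice.
  rcases hr0.eq_or_lt with rfl | hrpos
  · have hxu : 0 < xs u := by linarith
    have h1 := hstep ((δ + 1) / xs u) (by positivity) (by simp)
    rw [div_mul_cancel₀ _ hxu.ne'] at h1
    linarith
  · have h1 := hstep r⁻¹ (by positivity) (inv_mul_cancel₀ hrpos.ne').le
    rw [inv_mul_le_iff₀ hrpos] at h1
    linarith

end

end ConvexSublevel

/-- The topology on `StrongDual ℝ X` in `upperLimit` is that of the dual norm; the filter
`comap (weight) (𝓝 δ)` expresses `∑ᵢ μᵢ (Φ(x̄) - Φ_{tᵢ}(x̄) + εᵢ) → δ`. -/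
theorem corollary3p8 {X : Type*} [NormedAddCommGroup X] [NormedSpace ℝ X] [CompleteSpace X]
    (hX : ConvexSublevel.IsReflexiveSpace X)
    {T : Type*} [Nonempty T] (Φ : T → X → EReal)
    (hΦ : ∀ t, ConvexSublevel.IsGammaZero (Φ t))
    (xbar : X) (hxbar : xbar ∈ ConvexSublevel.effDom (fun x => ⨆ t, Φ t x))
    (δ : ℝ) (hδ : 0 ≤ δ) :
    ConvexSublevel.normalSet δ
        (ConvexSublevel.sublevel (fun x => ⨆ t, Φ t x) (⨆ t, Φ t xbar)) xbar =
      ConvexSublevel.upperLimit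
        (Filter.comap (ConvexSublevel.Param.weight Φ xbar) (𝓝 δ))
        (ConvexSublevel.Param.subdiffSum Φ xbar) := by
  have hbot : ⨆ t, Φ t xbar ≠ ⊥ := fun h =>
    (hΦ (Classical.arbitrary T)).ne_bot xbar (iSup_eq_bot.1 h _)
  obtain ⟨m, hm⟩ : ∃ m : ℝ, ⨆ t, Φ t xbar = m :=
    ⟨_, (EReal.coe_toReal (ne_of_lt hxbar) hbot).symm⟩
  have ha : ∀ t, Φ t xbar = ((Φ t xbar).toReal : ℝ) := fun t =>
    (EReal.coe_toReal (ne_of_lt ((le_iSup (fun t => Φ t xbar) t).trans_lt hxbar))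
      ((hΦ t).ne_bot xbar)).symm
  ext xs
  constructor
  · intro hxs W hW Z hZ
    obtain ⟨N, hN, hNZ⟩ := Filter.mem_comap.1 hZ
    obtain ⟨v, s, hvs⟩ := (hΦ (Classical.arbitrary T)).exists_isAffineMinorant
    have hne : (ConvexSublevel.minorantPairs Φ xbar m).Nonempty :=
      ⟨(v, s + m - v xbar), Classical.arbitrary T, by convert hvs using 1; ring⟩
    have hcl := ConvexSublevel.mem_closure_span_minorantPairs hX hΦ hm hne hδ (xs := xs)
      (fun u hu => hxs u (by
        change ⨆ t, Φ t u ≤ _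
        rw [hm]
        exact iSup_le hu))
    obtain ⟨q, ⟨hqW, hqN⟩, hq⟩ := mem_closure_iff_nhds.1 hcl _ (prod_mem_nhds hW hN)
    obtain ⟨p, hp, hpw⟩ := ConvexSublevel.exists_param_of_mem_span hm ha hne hq
    exact ⟨p, hNZ (by rw [Set.mem_preimage, hpw]; exact hqN), q.1, hp, hqW⟩
  · intro hxs u hu
    change ⨆ t, Φ t u ≤ _ at hu
    rw [hm] at hu
    refine le_of_forall_pos_le_add fun η hη => ?_
    have hW : {v : StrongDual ℝ X | xs (u - xbar) - η / 2 < v (u - xbar)} ∈ 𝓝 xs :=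
      (isOpen_lt continuous_const (by fun_prop)).mem_nhds (by
        change xs (u - xbar) - η / 2 < xs (u - xbar)
        linarith)
    obtain ⟨p, hp, v, hv, hvW⟩ := hxs _ hW _
      (Filter.preimage_mem_comap (Iio_mem_nhds (show δ < δ + η / 2 by linarith)))
    have h1 := ConvexSublevel.Param.apply_sub_le_weight hm ha hv hu
    change xs (u - xbar) - η / 2 < v (u - xbar) at hvW
    change ConvexSublevel.Param.weight Φ xbar p < δ + η / 2 at hp
    linarith
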